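/- Let $K$ be a field and $\Gamma$ a group with identity $\epsilon$. Algebras are associative but need not be unital or commutative. A (directed) hypergraph $H=(H^0,H^1,s,r)$ consists of a set $H^0$ of vertices, a set $H^1$ of hyperedges, and maps $s,r$ which assign to every $h\in H^1$ finite nonempty multisets $s(h)=\{s(h)_1,\dots,s(h)_{|s(h)|}\}$ and $r(h)=\{r(h)_1,\dots,r(h)_{|r(h)|}\}$ of vertices, whose elements we list in a fixed order. The Leavitt path algebra $L_K(H)$ is the $K$-algebra presented by the generators $v,\ h_{ij},\ h_{ij}^*$ ($v\in H^0$, $h\in H^1$, $1\le i\le |s(h)|$, $1\le j\le |r(h)|$) and the relations (i) $uv=\delta_{uv}u$ for $u,v\in H^0$; (ii) $s(h)_ih_{ij}=h_{ij}=h_{ij}r(h)_j$ and $r(h)_jh_{ij}^*=h_{ij}^*=h_{ij}^*s(h)_i$; (iii) $\sum_{k=1}^{|r(h)|}h_{ik}h_{jk}^*=\delta_{ij}s(h)_i$ for $h\in H^1$, $1\le i,j\le|s(h)|$; (iv) $\sum_{k=1}^{|s(h)|}h_{ki}^*h_{kj}=\delta_{ij}r(h)_i$ for $h\in H^1$, $1\le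 i,j\le|r(h)|$. Let $E^1=\{h_{ij}\mid h\in H^1,\ 1\le i\le|s(h)|,\ 1\le j\le|r(h)|\}$. A map $w:E^1\to\Gamma$ is an admissible weight map for $H$ if $w(h_{ij})=w(h_{i1})w(h_{11})^{-1}w(h_{1j})$ for all $h,i,j$. Such a $w$ induces a $\Gamma$-grading on $L_K(H)$ with $\deg(v)=\epsilon$, $\deg(h_{ij})=w(h_{ij})$ and $\deg(h_{ij}^*)=w(h_{ij})^{-1}$. For a $\Gamma$-graded $K$-algebra $R$, the smash product $R\#\Gamma$ is the $K$-algebra of all finite formal sums $\sum_{\gamma\in\Gamma}r^{(\gamma)}p_\gamma$ with $r^{(\gamma)}\in R$, with componentwise addition and scalar multiplication and with multiplication determined by bilinearity and $(rp_\alpha)(sp_\beta)=rs_{\alpha\beta^{-1}}p_\beta$, where $s_\gamma$ is the homogeneous component of $s$ of degree $\gamma$. The covering hypergraph $\overline H$ of $H$ defined by $w$ has vertices $v_\gamma$ ($v\in H^0$, $\gamma\in\Gamma$) and hyperedges $h_\gamma$ ($h\in H^1$, $\gamma\in\Gamma$), with $|\overline s(h_\gamma)|=|s(h)|$, $|\overline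 r(h_\gamma)|=|r(h)|$ and, in this order, $$\overline s(h_\gamma)_i=(s(h)_i)_{w(h_{i1})w(h_{11})^{-1}\gamma},\qquad \overline r(h_\gamma)_j=(r(h)_j)_{w(h_{1j})^{-1}\gamma}.$$ **Proposition.** Let $H$ be a hypergraph, $w:E^1\to\Gamma$ an admissible weight map for $H$ and $\overline H$ the covering hypergraph of $H$ defined by $w$. Then there is an isomorphism of $K$-algebras $\phi:L_K(\overline H)\to L_K(H)\#\Gamma$, where $L_K(H)$ carries the grading induced by $w$, such that $$\phi(v_\gamma)=vp_\gamma,\qquad \phi((h_\gamma)_{ij})=h_{ij}\,p_{w(h_{1j})^{-1}\gamma},\qquad \phi((h_\gamma)_{ij}^*)=h_{ij}^*\,p_{w(h_{i1})w(h_{11})^{-1}\gamma}$$ for all $\gamma\in\Gamma$, $v\in H^0$, $h\in H^1$, $1\le i\le|s(h)|$, $1\le j\le|r(h)|$. -/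

import Mathlib

universe u v

set_option linter.checkUnivs false in
/-- A (directed) hypergraph: every hyperedge has a finite nonempty multiset of sources and a
finite nonempty multiset of ranges. -/
structure DirHypergraph where
  V : Type u
  E : Type v
  src : E → Multiset V
  rng : E → Multiset V
  src_ne : ∀ h, src h ≠ 0
  rng_ne : ∀ h, rng h ≠ 0

namespace DirHypergraph

/-- A way of writing `src h = {s(h)_1, …, s(h)_m}` and `rng h = {r(h)_1, …, r(h)_n}` for every
hyperedge `h`; the indices run over `Fin (m h)` and `Fin (n h)`, hence start at `0`. -/
structure Ordering (H : DirHypergraph.{u, v}) where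
  m : H.E → ℕ
  n : H.E → ℕ
  s : ∀ h, Fin (m h) → H.V
  r : ∀ h, Fin (n h) → H.V
  map_s : ∀ h, (Finset.univ : Finset (Fin (m h))).val.map (s h) = H.src h
  map_r : ∀ h, (Finset.univ : Finset (Fin (n h))).val.map (r h) = H.rng h

namespace Ordering

variable {H : DirHypergraph.{u, v}} (o : H.Ordering)

theorem m_eq_card (h : H.E) : o.m h = Multiset.card (H.src h) := by
  rw [← o.map_s h]; simp

theorem n_eq_card (h : H.E) : o.n h = Multiset.card (H.rng h) := by
  rw [← o.map_r h]; simp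

theorem m_pos (h : H.E) : 0 < o.m h := by
  rw [o.m_eq_card]; exact Multiset.card_pos.2 (H.src_ne h)

theorem n_pos (h : H.E) : 0 < o.n h := by
  rw [o.n_eq_card]; exact Multiset.card_pos.2 (H.rng_ne h)

/-- The first index of the sources of `h`. -/
def i₁ (h : H.E) : Fin (o.m h) := ⟨0, o.m_pos h⟩

/-- The first index of the ranges of `h`. -/
def j₁ (h : H.E) : Fin (o.n h) := ⟨0, o.n_pos h⟩

/-- The generators `v`, `h_ij`, `h_ij^*`. -/
inductive Gen : Type (max u v)
  | vert (x : H.V) : Gen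
  | edge (h : H.E) (i : Fin (o.m h)) (j : Fin (o.n h)) : Gen
  | ghost (h : H.E) (i : Fin (o.m h)) (j : Fin (o.n h)) : Gen

end Ordering

end DirHypergraph

/-! ### The Leavitt path algebra -/

namespace Leavitt

open DirHypergraph

variable (K : Type*) [Field K] {H : DirHypergraph.{u, v}} (o : H.Ordering)

/-- The free non-unital associative algebra: the vector space with basis the nonempty words in
the generators, with juxtaposition of words as multiplication. -/
abbrev Free : Type _ := MonoidAlgebra K (FreeSemigroup o.Gen)

/-- A generator as an element of the free algebra. -/
noncomputable def fgen (x : o.Gen) : Free K o := MonoidAlgebra.single (FreeSemigroup.of x) 1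

/-- The defining relations of the Leavitt path algebra. -/
inductive Rel : Free K o → Free K o → Prop
  | vert_idem (x : H.V) :
      Rel (fgen K o (.vert x) * fgen K o (.vert x)) (fgen K o (.vert x))
  | vert_orth (x y : H.V) (hxy : x ≠ y) :
      Rel (fgen K o (.vert x) * fgen K o (.vert y)) 0
  | src_edge (h : H.E) (i : Fin (o.m h)) (j : Fin (o.n h)) :
      Rel (fgen K o (.vert (o.s h i)) * fgen K o (.edge h i j)) (fgen K o (.edge h i j))
  | edge_rng (h : H.E) (i : Fin (o.m h)) (j : Fin (o.n h)) :
      Rel (fgen K o (.edge h i j) * fgen K o (.vert (o.r h j))) (fgen K o (.edge h i j))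
  | rng_ghost (h : H.E) (i : Fin (o.m h)) (j : Fin (o.n h)) :
      Rel (fgen K o (.vert (o.r h j)) * fgen K o (.ghost h i j)) (fgen K o (.ghost h i j))
  | ghost_src (h : H.E) (i : Fin (o.m h)) (j : Fin (o.n h)) :
      Rel (fgen K o (.ghost h i j) * fgen K o (.vert (o.s h i))) (fgen K o (.ghost h i j))
  | edge_ghost (h : H.E) (i j : Fin (o.m h)) :
      Rel (∑ k : Fin (o.n h), fgen K o (.edge h i k) * fgen K o (.ghost h j k))
        (if i = j then fgen K o (.vert (o.s h i)) else 0)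
  | ghost_edge (h : H.E) (i j : Fin (o.n h)) :
      Rel (∑ k : Fin (o.m h), fgen K o (.ghost h k i) * fgen K o (.edge h k j))
        (if i = j then fgen K o (.vert (o.r h i)) else 0)

/-- The smallest congruence of non-unital `K`-algebras that contains the defining relations. As
the free algebra has no unit, closure under scalars is imposed explicitly. -/
noncomputable def con : RingCon (Free K o) :=
  ringConGen fun x y => ∃ (k : K) (a b : Free K o), Rel K o a b ∧ x = k • a ∧ y = k • b

variable {K o} in
theorem con_of_rel {a b : Free K o} (hab : Rel K o a b) : con K o a b :=
  RingConGen.Rel.of _ _ ⟨1, a, b, hab, (one_smul K a).symm, (one_smul K b).symm⟩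

variable {K o} in
theorem con_smul (k : K) {x y : Free K o} (hxy : con K o x y) : con K o (k • x) (k • y) := by
  change RingConGen.Rel _ x y at hxy
  change RingConGen.Rel _ (k • x) (k • y)
  induction hxy with
  | of x y hr =>
    obtain ⟨l, a, b, hab, rfl, rfl⟩ := hr
    exact .of _ _ ⟨k * l, a, b, hab, smul_smul k l a, smul_smul k l b⟩
  | refl x => exact .refl _
  | symm _ ih => exact ih.symm
  | trans _ _ ih1 ih2 => exact ih1.trans ih2
  | add _ _ ih1 ih2 => rw [smul_add, smul_add]; exact ih1.add ih2
  | mul _ h2 ih1 _ =>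
    rw [← smul_mul_assoc, ← smul_mul_assoc]; exact ih1.mul h2

end Leavitt

/-- The Leavitt path algebra `L_K(H)`: the associative, not necessarily unital, `K`-algebra
presented by the generators `Gen` and the relations `Rel`. -/
def Leavitt (K : Type*) [Field K] {H : DirHypergraph.{u, v}} (o : H.Ordering) : Type _ :=
  (Leavitt.con K o).Quotient

namespace Leavitt

open DirHypergraph

section Algebra

variable (K : Type*) [Field K] {H : DirHypergraph.{u, v}} (o : H.Ordering)

noncomputable instance : NonUnitalRing (Leavitt K o) := inferInstanceAs (NonUnitalRing (con K o).Quotient)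

/-- The class of an element of the free algebra. -/
noncomputable def mk (x : Free K o) : Leavitt K o := (con K o).toQuotient x

theorem mk_surjective : Function.Surjective (mk K o) := Quotient.mk''_surjective

theorem mk_zero : mk K o 0 = 0 := rfl

theorem mk_add (x y : Free K o) : mk K o (x + y) = mk K o x + mk K o y := rfl

theorem mk_mul (x y : Free K o) : mk K o (x * y) = mk K o x * mk K o y := rfl

variable {K o} in
theorem mk_eq {x y : Free K o} : mk K o x = mk K o y ↔ con K o x y := RingCon.eq _

noncomputable instance : SMul K (Leavitt K o) where
  smul k := Quotient.map' (k • ·) fun _ _ hxy => con_smul k hxy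

theorem mk_smul (k : K) (x : Free K o) : mk K o (k • x) = k • mk K o x := rfl

noncomputable instance : Module K (Leavitt K o) :=
  Function.Surjective.module K
    { toFun := mk K o, map_zero' := rfl, map_add' := fun _ _ => rfl }
    (mk_surjective K o) fun _ _ => rfl

instance : IsScalarTower K (Leavitt K o) (Leavitt K o) where
  smul_assoc k x y := by
    obtain ⟨x, rfl⟩ := mk_surjective K o x
    obtain ⟨y, rfl⟩ := mk_surjective K o y
    simp only [smul_eq_mul, ← mk_smul, ← mk_mul, smul_mul_assoc]

instance : SMulCommClass K (Leavitt K o) (Leavitt K o) where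
  smul_comm k x y := by
    obtain ⟨x, rfl⟩ := mk_surjective K o x
    obtain ⟨y, rfl⟩ := mk_surjective K o y
    simp only [smul_eq_mul, ← mk_smul, ← mk_mul, mul_smul_comm]

/-- The quotient map as a homomorphism of algebras. -/
noncomputable def mkHom : Free K o →ₙₐ[K] Leavitt K o where
  toFun := mk K o
  map_smul' _ _ := rfl
  map_zero' := rfl
  map_add' _ _ := rfl
  map_mul' _ _ := rfl

/-- A generator as an element of the Leavitt path algebra. -/
noncomputable def gen (x : o.Gen) : Leavitt K o := mk K o (fgen K o x)

/-- The element `v` of `L_K(H)`. -/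
noncomputable def vert (x : H.V) : Leavitt K o := gen K o (.vert x)

/-- The element `h_ij` of `L_K(H)`. -/
noncomputable def edge (h : H.E) (i : Fin (o.m h)) (j : Fin (o.n h)) : Leavitt K o :=
  gen K o (.edge h i j)

/-- The element `h_ij^*` of `L_K(H)`. -/
noncomputable def ghost (h : H.E) (i : Fin (o.m h)) (j : Fin (o.n h)) : Leavitt K o :=
  gen K o (.ghost h i j)

/-- The class of a word in the generators. -/
noncomputable def word (x : FreeSemigroup o.Gen) : Leavitt K o :=
  mk K o (MonoidAlgebra.single x 1)

theorem word_of (x : o.Gen) : word K o (FreeSemigroup.of x) = gen K o x := rfl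

theorem word_mul (x y : FreeSemigroup o.Gen) : word K o (x * y) = word K o x * word K o y := by
  rw [word, word, word, ← mk_mul, MonoidAlgebra.single_mul_single, one_mul]

theorem span_word : Submodule.span K (Set.range (word K o)) = ⊤ := by
  rw [eq_top_iff]
  rintro x -
  obtain ⟨x, rfl⟩ := mk_surjective K o x
  induction x using MonoidAlgebra.induction_linear with
  | zero => exact Submodule.zero_mem _
  | add x y hx hy => rw [mk_add]; exact Submodule.add_mem _ hx hy
  | single a k =>
    have e : (MonoidAlgebra.single a k : Free K o) = k • MonoidAlgebra.single a 1 := by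
      rw [MonoidAlgebra.smul_single', mul_one]
    rw [e, mk_smul]
    exact Submodule.smul_mem _ _ (Submodule.subset_span ⟨a, rfl⟩)

/-- The homomorphism from the free algebra determined by the images of the generators. -/
noncomputable def freeLift {A : Type*} [NonUnitalRing A] [Module K A] [IsScalarTower K A A]
    [SMulCommClass K A A] (f : o.Gen → A) : Free K o →ₙₐ[K] A :=
  MonoidAlgebra.liftMagma K (FreeSemigroup.lift f)

variable {K o} in
theorem freeLift_fgen {A : Type*} [NonUnitalRing A] [Module K A] [IsScalarTower K A A]
    [SMulCommClass K A A] (f : o.Gen → A) (x : o.Gen) : freeLift K o f (fgen K o x) = f x := by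
  simp [freeLift, fgen, MonoidAlgebra.liftMagma]

/-- The universal property of the Leavitt path algebra. -/
noncomputable def lift {A : Type*} [NonUnitalRing A] [Module K A] [IsScalarTower K A A]
    [SMulCommClass K A A] (f : o.Gen → A)
    (hf : ∀ a b, Rel K o a b → freeLift K o f a = freeLift K o f b) : Leavitt K o →ₙₐ[K] A :=
  have key : ∀ a b, con K o a b → freeLift K o f a = freeLift K o f b := by
    intro a b hab
    change RingConGen.Rel _ a b at hab
    induction hab with
    | of x y hr =>
      obtain ⟨l, a, b, hab, rfl, rfl⟩ := hr
      rw [map_smul, map_smul, hf a b hab]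
    | refl x => rfl
    | symm _ ih => exact ih.symm
    | trans _ _ ih1 ih2 => exact ih1.trans ih2
    | add _ _ ih1 ih2 => rw [map_add, map_add, ih1, ih2]
    | mul _ _ ih1 ih2 => rw [map_mul, map_mul, ih1, ih2]
  { toFun := fun x => Quotient.liftOn' x (freeLift K o f) key
    map_smul' := fun k x => by
      obtain ⟨x, rfl⟩ := mk_surjective K o x
      exact map_smul (freeLift K o f) k x
    map_zero' := map_zero (freeLift K o f)
    map_add' := fun x y => by
      obtain ⟨x, rfl⟩ := mk_surjective K o x
      obtain ⟨y, rfl⟩ := mk_surjective K o y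
      exact map_add (freeLift K o f) x y
    map_mul' := fun x y => by
      obtain ⟨x, rfl⟩ := mk_surjective K o x
      obtain ⟨y, rfl⟩ := mk_surjective K o y
      exact map_mul (freeLift K o f) x y }

variable {K o} in
theorem lift_gen {A : Type*} [NonUnitalRing A] [Module K A] [IsScalarTower K A A]
    [SMulCommClass K A A] (f : o.Gen → A)
    (hf : ∀ a b, Rel K o a b → freeLift K o f a = freeLift K o f b) (x : o.Gen) :
    lift K o f hf (gen K o x) = f x :=
  freeLift_fgen f x

end Algebra

end Leavitt

/-! ### Gradings by a group and smash products -/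

open Classical in
/-- A grading of a (not necessarily unital) `K`-algebra `R` by a group `Γ`: a decomposition
`R = ⨁ γ, part γ` into subspaces with `part α * part β ⊆ part (α * β)`. -/
structure GroupGrading (Γ : Type*) [Group Γ] (K : Type*) [Field K] (R : Type*) [NonUnitalRing R]
    [Module K R] where
  part : Γ → Submodule K R
  isInternal : DirectSum.IsInternal part
  mul_mem : ∀ {α β : Γ} {a b : R}, a ∈ part α → b ∈ part β → a * b ∈ part (α * β)

namespace GroupGrading

variable {Γ : Type*} [Group Γ] {K : Type*} [Field K] {R : Type*} [NonUnitalRing R] [Module K R]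
  (G : GroupGrading Γ K R)

open Classical in
/-- The homogeneous component `r_γ` of degree `γ` of an element `r`. -/
noncomputable def comp (γ : Γ) : R →ₗ[K] R :=
  letI := G.isInternal.chooseDecomposition
  (G.part γ).subtype ∘ₗ DirectSum.component K Γ (fun i => G.part i) γ ∘ₗ
    (DirectSum.decomposeLinearEquiv G.part).toLinearMap

theorem comp_mem (γ : Γ) (a : R) : G.comp γ a ∈ G.part γ := by
  simp [comp]

theorem comp_of_mem {γ : Γ} {a : R} (ha : a ∈ G.part γ) : G.comp γ a = a := by
  classical
  let := G.isInternal.chooseDecomposition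
  exact DirectSum.decompose_of_mem_same G.part ha

theorem comp_of_mem_ne {γ δ : Γ} {a : R} (ha : a ∈ G.part γ) (h : γ ≠ δ) : G.comp δ a = 0 := by
  classical
  let := G.isInternal.chooseDecomposition
  exact DirectSum.decompose_of_mem_ne G.part ha h

theorem iSup_part : ⨆ γ, G.part γ = ⊤ := by
  classical
  exact G.isInternal.submodule_iSup_eq_top

theorem comp_mul_of_mem {δ : Γ} {b : R} (hb : b ∈ G.part δ) (γ : Γ) (a : R) :
    G.comp γ (a * b) = G.comp (γ * δ⁻¹) a * b := by
  have ha : a ∈ ⨆ γ, G.part γ := by rw [G.iSup_part]; trivial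
  induction ha using Submodule.iSup_induction' with
  | mem σ a ha =>
    by_cases h : σ * δ = γ
    · subst h
      rw [G.comp_of_mem (G.mul_mem ha hb), mul_inv_cancel_right, G.comp_of_mem ha]
    · rw [G.comp_of_mem_ne (G.mul_mem ha hb) h, G.comp_of_mem_ne ha, zero_mul]
      rintro rfl
      simp at h
  | zero => simp
  | add x y _ _ hx hy => rw [add_mul, map_add, map_add, add_mul, hx, hy]

end GroupGrading

/-- The smash product `R # Γ`: finite formal sums `∑ r^(γ) p_γ` with the coefficients `r^(γ)` in
`R`. -/
def SmashProduct {Γ : Type*} [Group Γ] {K : Type*} [Field K] {R : Type*} [NonUnitalRing R]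
    [Module K R] (_G : GroupGrading Γ K R) : Type _ := Γ →₀ R

namespace SmashProduct

section

variable {Γ : Type*} [Group Γ] {K : Type*} [Field K] {R : Type*} [NonUnitalRing R] [Module K R]
  (G : GroupGrading Γ K R)

noncomputable instance : AddCommGroup (SmashProduct G) := inferInstanceAs (AddCommGroup (Γ →₀ R))

noncomputable instance : Module K (SmashProduct G) := inferInstanceAs (Module K (Γ →₀ R))

/-- The element `r p_γ`. -/
noncomputable def single (r : R) (γ : Γ) : SmashProduct G := Finsupp.single γ r

theorem single_add (r r' : R) (γ : Γ) : single G (r + r') γ = single G r γ + single G r' γ :=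
  Finsupp.single_add γ r r'

theorem single_zero (γ : Γ) : single G 0 γ = 0 := Finsupp.single_zero γ

theorem smul_single (k : K) (r : R) (γ : Γ) : k • single G r γ = single G (k • r) γ :=
  Finsupp.smul_single k γ r

variable {G} in
@[elab_as_elim]
theorem induction_on {motive : SmashProduct G → Prop} (x : SmashProduct G) (zero : motive 0)
    (add : ∀ x y, motive x → motive y → motive (x + y))
    (single : ∀ r γ, motive (single G r γ)) : motive x :=
  Finsupp.induction_linear x zero add fun γ r => single r γ

/-- The bilinear extension of `(r p_α) (s p_β) = (r s_{α β⁻¹}) p_β`. -/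
noncomputable instance : Mul (SmashProduct G) where
  mul x y := Finsupp.sum (M := R) x fun α r =>
    Finsupp.sum (M := R) y fun β s => single G (r * G.comp (α * β⁻¹) s) β

theorem mul_def (x y : SmashProduct G) : x * y = Finsupp.sum (M := R) x fun α r =>
    Finsupp.sum (M := R) y fun β s => single G (r * G.comp (α * β⁻¹) s) β := rfl

theorem single_mul_single (r s : R) (α β : Γ) :
    single G r α * single G s β = single G (r * G.comp (α * β⁻¹) s) β := by
  rw [mul_def, single, Finsupp.sum_single_index, single, Finsupp.sum_single_index]
  · simp [single_zero]
  · simp only [zero_mul, single_zero]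
    exact Finset.sum_const_zero

noncomputable instance : NonUnitalNonAssocRing (SmashProduct G) where
  zero_mul y := Finsupp.sum_zero_index
  mul_zero x := by
    rw [mul_def]
    exact Finset.sum_eq_zero fun α _ => Finsupp.sum_zero_index
  left_distrib x y z := by
    classical
    simp only [mul_def]
    refine Eq.trans (Finset.sum_congr rfl fun α _ => ?_) Finset.sum_add_distrib
    exact Finsupp.sum_add_index' (fun β => by simp [single_zero])
      (fun β s s' => by rw [map_add, mul_add, single_add])
  right_distrib x y z := by
    classical
    simp only [mul_def]
    refine Finsupp.sum_add_index' (fun α => ?_) (fun α r r' => ?_)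
    · exact Finset.sum_eq_zero fun β _ => by simp [single_zero]
    · refine Eq.trans (Finset.sum_congr rfl fun β _ => ?_) Finset.sum_add_distrib
      change single G ((r + r') * _) β = single G (r * _) β + single G (r' * _) β
      rw [add_mul, single_add]

noncomputable instance : NonUnitalRing (SmashProduct G) where
  mul_assoc x y z := by
    induction x using induction_on with
    | zero => simp only [zero_mul]
    | add x x' hx hx' => simp only [add_mul, hx, hx']
    | single r α =>
      induction y using induction_on with
      | zero => simp only [zero_mul, mul_zero]
      | add y y' hy hy' => simp only [add_mul, mul_add, hy, hy']
      | single s β =>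
        induction z using induction_on with
        | zero => simp only [mul_zero]
        | add z z' hz hz' => simp only [mul_add, hz, hz']
        | single t γ =>
          simp only [single_mul_single]
          rw [G.comp_mul_of_mem (G.comp_mem _ t), mul_assoc]
          congr 4
          group

instance [IsScalarTower K R R] : IsScalarTower K (SmashProduct G) (SmashProduct G) where
  smul_assoc k x y := by
    simp only [smul_eq_mul]
    induction x using induction_on with
    | zero => simp
    | add x x' hx hx' => simp only [smul_add, add_mul, hx, hx']
    | single r α =>
      induction y using induction_on with
      | zero => simp
      | add y y' hy hy' => simp only [smul_add, mul_add, hy, hy']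
      | single s β => simp only [smul_single, single_mul_single, smul_mul_assoc]

instance [SMulCommClass K R R] : SMulCommClass K (SmashProduct G) (SmashProduct G) where
  smul_comm k x y := by
    simp only [smul_eq_mul]
    induction x using induction_on with
    | zero => simp
    | add x x' hx hx' => simp only [smul_add, add_mul, hx, hx']
    | single r α =>
      induction y using induction_on with
      | zero => simp
      | add y y' hy hy' => simp only [smul_add, mul_add, hy, hy']
      | single s β => simp only [smul_single, single_mul_single, map_smul, mul_smul_comm]

end

end SmashProduct

/-! ### Admissible weight maps and the induced grading -/

namespace DirHypergraph.Ordering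

variable {H : DirHypergraph.{u, v}} (o : H.Ordering) {Γ : Type*} [Group Γ]

/-- A weight map assigns an element of `Γ` to every `h_ij`. It is admissible if
`w(h_ij) = w(h_i1) w(h_11)⁻¹ w(h_1j)`. -/
def IsAdmissible (w : ∀ h : H.E, Fin (o.m h) → Fin (o.n h) → Γ) : Prop :=
  ∀ h i j, w h i j = w h i (o.j₁ h) * (w h (o.i₁ h) (o.j₁ h))⁻¹ * w h (o.i₁ h) j

/-- The degree of a generator. -/
def genDeg (w : ∀ h : H.E, Fin (o.m h) → Fin (o.n h) → Γ) : o.Gen → Γ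
  | .vert _ => 1
  | .edge h i j => w h i j
  | .ghost h i j => (w h i j)⁻¹

/-- The degree of a word: the product of the degrees of its letters. -/
def wordDeg (w : ∀ h : H.E, Fin (o.m h) → Fin (o.n h) → Γ) : FreeSemigroup o.Gen →ₙ* Γ :=
  FreeSemigroup.lift (o.genDeg w)

end DirHypergraph.Ordering

namespace Leavitt

open DirHypergraph TensorProduct

section Grading

variable (K : Type*) [Field K] {H : DirHypergraph.{u, v}} (o : H.Ordering) {Γ : Type*} [Group Γ]
  {w : ∀ h : H.E, Fin (o.m h) → Fin (o.n h) → Γ}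

variable {K o} in
theorem mk_rel {a b : Free K o} (hab : Rel K o a b) : mk K o a = mk K o b :=
  mk_eq.2 (con_of_rel hab)

theorem vert_mul_self (x : H.V) : vert K o x * vert K o x = vert K o x :=
  mk_rel (.vert_idem x)

theorem vert_mul_of_ne {x y : H.V} (hxy : x ≠ y) : vert K o x * vert K o y = 0 :=
  mk_rel (.vert_orth x y hxy)

theorem vert_mul_edge (h : H.E) (i : Fin (o.m h)) (j : Fin (o.n h)) :
    vert K o (o.s h i) * edge K o h i j = edge K o h i j :=
  mk_rel (.src_edge h i j)

theorem edge_mul_vert (h : H.E) (i : Fin (o.m h)) (j : Fin (o.n h)) :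
    edge K o h i j * vert K o (o.r h j) = edge K o h i j :=
  mk_rel (.edge_rng h i j)

theorem vert_mul_ghost (h : H.E) (i : Fin (o.m h)) (j : Fin (o.n h)) :
    vert K o (o.r h j) * ghost K o h i j = ghost K o h i j :=
  mk_rel (.rng_ghost h i j)

theorem ghost_mul_vert (h : H.E) (i : Fin (o.m h)) (j : Fin (o.n h)) :
    ghost K o h i j * vert K o (o.s h i) = ghost K o h i j :=
  mk_rel (.ghost_src h i j)

theorem sum_edge_mul_ghost (h : H.E) (i j : Fin (o.m h)) :
    ∑ k : Fin (o.n h), edge K o h i k * ghost K o h j k =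
      if i = j then vert K o (o.s h i) else 0 := by
  have e := map_sum (mkHom K o) (fun k : Fin (o.n h) =>
    fgen K o (.edge h i k) * fgen K o (.ghost h j k)) Finset.univ
  refine e.symm.trans ((mk_rel (.edge_ghost h i j)).trans ?_)
  split_ifs <;> rfl

theorem sum_ghost_mul_edge (h : H.E) (i j : Fin (o.n h)) :
    ∑ k : Fin (o.m h), ghost K o h k i * edge K o h k j =
      if i = j then vert K o (o.r h i) else 0 := by
  have e := map_sum (mkHom K o) (fun k : Fin (o.m h) =>
    fgen K o (.ghost h k i) * fgen K o (.edge h k j)) Finset.univ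
  refine e.symm.trans ((mk_rel (.ghost_edge h i j)).trans ?_)
  split_ifs <;> rfl

/-- The map that sends a word `x` of degree `γ` to `x ⊗ γ`; it separates the degrees. -/
noncomputable def coaction (hw : o.IsAdmissible w) :
    Leavitt K o →ₙₐ[K] Leavitt K o ⊗[K] MonoidAlgebra K Γ :=
  lift K o (fun x => gen K o x ⊗ₜ MonoidAlgebra.single (o.genDeg w x) 1) (by
    have h1 : ∀ (h : H.E) (i j : Fin (o.m h)) (k : Fin (o.n h)),
        w h i k * (w h j k)⁻¹ = w h i (o.j₁ h) * (w h j (o.j₁ h))⁻¹ := by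
      intro h i j k
      rw [hw h i k, hw h j k]
      group
    have h2 : ∀ (h : H.E) (i j : Fin (o.n h)) (k : Fin (o.m h)),
        (w h k i)⁻¹ * w h k j = (w h (o.i₁ h) i)⁻¹ * w h (o.i₁ h) j := by
      intro h i j k
      rw [hw h k i, hw h k j]
      group
    intro a b hab
    cases hab with
    | vert_idem x =>
      simp only [map_mul, freeLift_fgen, Algebra.TensorProduct.tmul_mul_tmul,
        MonoidAlgebra.single_mul_single, DirHypergraph.Ordering.genDeg, mul_one]
      exact congrArg (· ⊗ₜ _) (vert_mul_self K o x)
    | vert_orth x y hxy =>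
      simp only [map_mul, map_zero, freeLift_fgen, Algebra.TensorProduct.tmul_mul_tmul]
      exact (congrArg (· ⊗ₜ _) (vert_mul_of_ne K o hxy)).trans (zero_tmul _ _)
    | src_edge h i j =>
      simp only [map_mul, freeLift_fgen, Algebra.TensorProduct.tmul_mul_tmul,
        MonoidAlgebra.single_mul_single, DirHypergraph.Ordering.genDeg, mul_one, one_mul]
      exact congrArg (· ⊗ₜ _) (vert_mul_edge K o h i j)
    | edge_rng h i j =>
      simp only [map_mul, freeLift_fgen, Algebra.TensorProduct.tmul_mul_tmul,
        MonoidAlgebra.single_mul_single, DirHypergraph.Ordering.genDeg, mul_one]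
      exact congrArg (· ⊗ₜ _) (edge_mul_vert K o h i j)
    | rng_ghost h i j =>
      simp only [map_mul, freeLift_fgen, Algebra.TensorProduct.tmul_mul_tmul,
        MonoidAlgebra.single_mul_single, DirHypergraph.Ordering.genDeg, mul_one, one_mul]
      exact congrArg (· ⊗ₜ _) (vert_mul_ghost K o h i j)
    | ghost_src h i j =>
      simp only [map_mul, freeLift_fgen, Algebra.TensorProduct.tmul_mul_tmul,
        MonoidAlgebra.single_mul_single, DirHypergraph.Ordering.genDeg, mul_one]
      exact congrArg (· ⊗ₜ _) (ghost_mul_vert K o h i j)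
    | edge_ghost h i j =>
      simp only [map_sum, map_mul, freeLift_fgen, Algebra.TensorProduct.tmul_mul_tmul,
        MonoidAlgebra.single_mul_single, DirHypergraph.Ordering.genDeg, mul_one, h1]
      rw [← sum_tmul]
      refine (congrArg (· ⊗ₜ _) (sum_edge_mul_ghost K o h i j)).trans ?_
      split_ifs with hij
      · subst hij
        rw [freeLift_fgen, mul_inv_cancel]
        rfl
      · rw [map_zero, zero_tmul]
    | ghost_edge h i j =>
      simp only [map_sum, map_mul, freeLift_fgen, Algebra.TensorProduct.tmul_mul_tmul,
        MonoidAlgebra.single_mul_single, DirHypergraph.Ordering.genDeg, mul_one, h2]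
      rw [← sum_tmul]
      refine (congrArg (· ⊗ₜ _) (sum_ghost_mul_edge K o h i j)).trans ?_
      split_ifs with hij
      · subst hij
        rw [freeLift_fgen, inv_mul_cancel]
        rfl
      · rw [map_zero, zero_tmul])

theorem coaction_word (hw : o.IsAdmissible w) (x : FreeSemigroup o.Gen) :
    coaction K o hw (word K o x) =
      word K o x ⊗ₜ MonoidAlgebra.single (o.wordDeg w x) 1 := by
  induction x using FreeSemigroup.recOnMul with
  | ih1 x => exact lift_gen _ _ x
  | ih2 x y hx hy =>
    have hx' : coaction K o hw (word K o (FreeSemigroup.of x)) =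
        word K o (FreeSemigroup.of x) ⊗ₜ
          MonoidAlgebra.single (o.wordDeg w (FreeSemigroup.of x)) 1 := hx
    rw [word_mul, map_mul, hx', hy, Algebra.TensorProduct.tmul_mul_tmul,
      MonoidAlgebra.single_mul_single, one_mul, map_mul]

variable (w) in
/-- The span of all words of degree `γ`. -/
noncomputable def degPart (γ : Γ) : Submodule K (Leavitt K o) :=
  Submodule.span K (word K o '' {x | o.wordDeg w x = γ})

/-- Extraction of the coefficient of `γ`. -/
noncomputable def coeffMap (γ : Γ) : Leavitt K o ⊗[K] MonoidAlgebra K Γ →ₗ[K] Leavitt K o :=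
  (TensorProduct.rid K (Leavitt K o)).toLinearMap ∘ₗ
    LinearMap.lTensor (Leavitt K o)
      (Finsupp.lapply γ ∘ₗ (MonoidAlgebra.coeffLinearEquiv K).toLinearMap)

/-- The projection to the component of degree `γ`. -/
noncomputable def proj (hw : o.IsAdmissible w) (γ : Γ) : Leavitt K o →ₗ[K] Leavitt K o :=
  coeffMap K o γ ∘ₗ (coaction K o hw : Leavitt K o →ₗ[K] Leavitt K o ⊗[K] MonoidAlgebra K Γ)

theorem proj_of_mem (hw : o.IsAdmissible w) {γ : Γ} {a : Leavitt K o}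
    (ha : a ∈ degPart K o w γ) : proj K o hw γ a = a := by
  induction ha using Submodule.span_induction with
  | mem a ha =>
    obtain ⟨x, rfl, rfl⟩ := ha
    simp [proj, coeffMap, coaction_word]
  | zero => exact map_zero _
  | add a b _ _ ha hb => rw [map_add, ha, hb]
  | smul k a _ ha => rw [map_smul, ha]

theorem proj_of_mem_ne (hw : o.IsAdmissible w) {γ δ : Γ} (hne : γ ≠ δ) {a : Leavitt K o}
    (ha : a ∈ degPart K o w γ) : proj K o hw δ a = 0 := by
  induction ha using Submodule.span_induction with
  | mem a ha =>
    obtain ⟨x, rfl, rfl⟩ := ha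
    simp [proj, coeffMap, coaction_word, hne]
  | zero => exact map_zero _
  | add a b _ _ ha hb => rw [map_add, ha, hb, add_zero]
  | smul k a _ ha => rw [map_smul, ha, smul_zero]

/-- The grading of `L_K(H)` induced by an admissible weight map: the component of degree `γ` is
spanned by the words of degree `γ`, where `v`, `h_ij` and `h_ij^*` have the degrees `1`, `w(h_ij)`
and `w(h_ij)⁻¹`. -/
noncomputable def grading (hw : o.IsAdmissible w) : GroupGrading Γ K (Leavitt K o) where
  part := degPart K o w
  isInternal := by
    classical
    rw [DirectSum.isInternal_submodule_iff_iSupIndep_and_iSup_eq_top]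
    constructor
    · intro γ
      rw [Submodule.disjoint_def]
      intro a ha ha'
      rw [← proj_of_mem K o hw ha]
      have hle : (⨆ δ, ⨆ (_ : δ ≠ γ), degPart K o w δ) ≤ LinearMap.ker (proj K o hw γ) :=
        iSup₂_le fun δ hδ b hb => LinearMap.mem_ker.2 (proj_of_mem_ne K o hw hδ hb)
      exact LinearMap.mem_ker.1 (hle ha')
    · rw [eq_top_iff, ← span_word, Submodule.span_le]
      rintro _ ⟨x, rfl⟩
      exact Submodule.mem_iSup_of_mem (o.wordDeg w x) (Submodule.subset_span ⟨x, rfl, rfl⟩)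
  mul_mem := by
    intro α β a b ha hb
    induction ha using Submodule.span_induction with
    | mem a ha =>
      obtain ⟨x, rfl, rfl⟩ := ha
      induction hb using Submodule.span_induction with
      | mem b hb =>
        obtain ⟨y, rfl, rfl⟩ := hb
        exact Submodule.subset_span ⟨x * y, map_mul _ x y, word_mul K o x y⟩
      | zero => rw [mul_zero]; exact Submodule.zero_mem _
      | add b c _ _ hb hc => rw [mul_add]; exact Submodule.add_mem _ hb hc
      | smul k b _ hb => rw [mul_smul_comm]; exact Submodule.smul_mem _ _ hb
    | zero => rw [zero_mul]; exact Submodule.zero_mem _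
    | add a c _ _ ha hc => rw [add_mul]; exact Submodule.add_mem _ ha hc
    | smul k a _ ha => rw [smul_mul_assoc]; exact Submodule.smul_mem _ _ ha

end Grading

end Leavitt

/-! ### The covering hypergraph -/

namespace DirHypergraph.Ordering

variable {H : DirHypergraph.{u, v}} (o : H.Ordering) {Γ : Type*} [Group Γ]
  (w : ∀ h : H.E, Fin (o.m h) → Fin (o.n h) → Γ)

/-- The vertex `(s(h)_i)_{w(h_i1) w(h_11)⁻¹ γ}`, which for `i = 1` is `(s(h)_1)_γ`. -/
def coverS (h : H.E × Γ) (i : Fin (o.m h.1)) : H.V × Γ :=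
  (o.s h.1 i, w h.1 i (o.j₁ h.1) * (w h.1 (o.i₁ h.1) (o.j₁ h.1))⁻¹ * h.2)

/-- The vertex `(r(h)_j)_{w(h_1j)⁻¹ γ}`. -/
def coverR (h : H.E × Γ) (j : Fin (o.n h.1)) : H.V × Γ :=
  (o.r h.1 j, (w h.1 (o.i₁ h.1) j)⁻¹ * h.2)

/-- The covering hypergraph: its vertices `v_γ` and hyperedges `h_γ` are the pairs `(v, γ)` and
`(h, γ)`. -/
abbrev covering : DirHypergraph where
  V := H.V × Γ
  E := H.E × Γ
  src h := (Finset.univ : Finset (Fin (o.m h.1))).val.map (o.coverS w h)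
  rng h := (Finset.univ : Finset (Fin (o.n h.1))).val.map (o.coverR w h)
  src_ne h := by
    rw [← Multiset.card_pos]
    simpa using o.m_pos h.1
  rng_ne h := by
    rw [← Multiset.card_pos]
    simpa using o.n_pos h.1

/-- The sources and ranges of `h_γ` are listed in the same order as those of `h`. -/
abbrev coveringOrdering : (o.covering w).Ordering where
  m h := o.m h.1
  n h := o.n h.1
  s h := o.coverS w h
  r h := o.coverR w h
  map_s _ := rfl
  map_r _ := rfl

end DirHypergraph.Ordering

/-! A generator of the covering algebra is the same thing as a generator `x` of the base together
with an element `γ` of `Γ`, the index of its right end; its left end then has index `deg x * γ`. In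
the smash product `x p_γ` behaves in the same way: for homogeneous `s`, the product `(r p_α)(s p_β)`
is `r s p_β` if `α = deg s * β` and zero otherwise, which is the condition that two lifted arrows
can be composed. Hence the prescribed images satisfy the relations of the covering algebra, which
gives `toSmash`. Admissibility makes the left index of `(h_γ)_ij` independent of `j`, and keeps all
summands of relations (iii) and (iv) over one hyperedge of the cover.

Surjectivity: the elements `r p_γ` with `r` a word span, and a word lifts letter by letter from the
right once the index of its right end is chosen (`single_word_mem_range`).

Injectivity: no normal form for elements of the covering algebra is needed. The base algebra acts on
a direct sum, indexed by `Γ`, of copies of the unitized covering algebra: a generator multiplies the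
component at `γ` by its lift at `γ` and moves the result to `deg x * γ` (`coverAction`). Letting `r`
act on the unit at `γ` recovers the lift of `r` ending at `γ`, so `r p_γ` can be sent back to the
covering algebra (`ofSmash`). This linear map intertwines left multiplication by generators
(`ofSmash_mul`), so it is a left inverse of `toSmash`. -/

namespace DirHypergraph.Ordering

variable {H : DirHypergraph.{u, v}} (o : H.Ordering) {Γ : Type*} [Group Γ]
  (w : ∀ h : H.E, Fin (o.m h) → Fin (o.n h) → Γ)

/-! ### Generators of the cover as pairs (generator, index of the right end) -/

/-- The generator of the base hypergraph below a generator of the covering hypergraph. -/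
def coverBase : (o.coveringOrdering w).Gen → o.Gen
  | .vert x => .vert x.1
  | .edge h i j => .edge h.1 i j
  | .ghost h i j => .ghost h.1 i j

/-- The index of the right end of a generator of the covering hypergraph. -/
def coverIdx : (o.coveringOrdering w).Gen → Γ
  | .vert x => x.2
  | .edge h _ j => (w h.1 (o.i₁ h.1) j)⁻¹ * h.2
  | .ghost h i _ => w h.1 i (o.j₁ h.1) * (w h.1 (o.i₁ h.1) (o.j₁ h.1))⁻¹ * h.2

/-- The generator above `x` whose right end has the index `γ`. -/
def coverGen : o.Gen → Γ → (o.coveringOrdering w).Gen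
  | .vert x, γ => .vert (x, γ)
  | .edge h i j, γ => .edge (h, w h (o.i₁ h) j * γ) i j
  | .ghost h i j, γ => .ghost (h, w h (o.i₁ h) (o.j₁ h) * (w h i (o.j₁ h))⁻¹ * γ) i j

/-- The right-end index is a fixed left translate of the index of the hyperedge, so either
determines the other. With the next two identities this makes the generators of the cover correspond
bijectively to `o.Gen × Γ`, for any weight map. -/
theorem coverGen_coverBase (x : (o.coveringOrdering w).Gen) :
    o.coverGen w (o.coverBase w x) (o.coverIdx w x) = x := by
  cases x with
  | vert x => rfl
  | edge h i j => simp [coverGen, coverBase, coverIdx]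
  | ghost h i j =>
    obtain ⟨h, γ⟩ := h
    simp only [coverGen, coverBase, coverIdx]
    congr 2
    group

theorem coverBase_coverGen (x : o.Gen) (γ : Γ) : o.coverBase w (o.coverGen w x γ) = x := by
  cases x <;> rfl

theorem coverIdx_coverGen (x : o.Gen) (γ : Γ) : o.coverIdx w (o.coverGen w x γ) = γ := by
  cases x with
  | vert x => rfl
  | edge h i j => simp [coverGen, coverIdx]
  | ghost h i j => simp only [coverGen, coverIdx]; group

end DirHypergraph.Ordering

/-! ### Homogeneous words and products of monomials in the smash product -/

namespace Leavitt

open DirHypergraph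

section Smash

variable (K : Type*) [Field K] {H : DirHypergraph.{u, v}} (o : H.Ordering) {Γ : Type*} [Group Γ]
  {w : ∀ h : H.E, Fin (o.m h) → Fin (o.n h) → Γ} (hw : o.IsAdmissible w)

theorem word_mem_part (x : FreeSemigroup o.Gen) :
    word K o x ∈ (grading K o hw).part (o.wordDeg w x) :=
  Submodule.subset_span ⟨x, rfl, rfl⟩

theorem gen_mem_part (x : o.Gen) : gen K o x ∈ (grading K o hw).part (o.genDeg w x) :=
  word_mem_part K o hw (FreeSemigroup.of x)

end Smash

end Leavitt

namespace SmashProduct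

variable {Γ : Type*} [Group Γ] {K : Type*} [Field K] {R : Type*} [NonUnitalRing R] [Module K R]
  (G : GroupGrading Γ K R)

/-- Composability in the smash product: a factor of degree `δ` with right index `β` has left index
`δ * β`, and only that index on its left survives. The mismatched case follows. -/
theorem single_mul_single_of_eq {r s : R} {α β δ : Γ} (hs : s ∈ G.part δ) (h : α = δ * β) :
    single G r α * single G s β = single G (r * s) β := by
  subst h
  rw [single_mul_single, mul_inv_cancel_right, G.comp_of_mem hs]

theorem single_mul_single_of_ne {r s : R} {α β δ : Γ} (hs : s ∈ G.part δ) (h : α ≠ δ * β) :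
    single G r α * single G s β = 0 := by
  rw [single_mul_single, G.comp_of_mem_ne hs, mul_zero, single_zero]
  rintro rfl
  simp at h

theorem single_sum {ι : Type*} (s : Finset ι) (f : ι → R) (γ : Γ) :
    single G (∑ i ∈ s, f i) γ = ∑ i ∈ s, single G (f i) γ :=
  map_sum (Finsupp.singleAddHom γ) f s

end SmashProduct

/-! ### The homomorphism to the smash product and its surjectivity -/

namespace Leavitt

open DirHypergraph

section Cover

variable (K : Type*) [Field K] {H : DirHypergraph.{u, v}} (o : H.Ordering) {Γ : Type*} [Group Γ]
  {w : ∀ h : H.E, Fin (o.m h) → Fin (o.n h) → Γ} (hw : o.IsAdmissible w)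

/-- The homomorphism from the Leavitt path algebra of the covering hypergraph to the smash
product. -/
noncomputable def toSmash :
    Leavitt K (o.coveringOrdering w) →ₙₐ[K] SmashProduct (grading K o hw) :=
  lift K (o.coveringOrdering w)
    (fun x => SmashProduct.single _ (gen K o (o.coverBase w x)) (o.coverIdx w x)) (by
    have hg := gen_mem_part K o hw
    intro a b hab
    cases hab with
    | vert_idem x =>
      rw [map_mul, freeLift_fgen, SmashProduct.single_mul_single_of_eq _ (hg _)]
      · exact congrArg (SmashProduct.single _ · _) (vert_mul_self K o x.1)
      · simp [Ordering.coverBase, Ordering.genDeg]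
    | vert_orth x y hxy =>
      rw [map_mul, freeLift_fgen, freeLift_fgen, map_zero]
      -- Distinct vertices of the cover differ in their base vertex, where orthogonality in the base
      -- algebra applies, or in their index, where the smash product itself gives zero.
      by_cases h : x.2 = y.2
      · have h' : x.1 ≠ y.1 := fun e => hxy (Prod.ext e h)
        rw [SmashProduct.single_mul_single_of_eq _ (hg _)]
        · exact (congrArg (SmashProduct.single _ · _) (vert_mul_of_ne K o h')).trans
            (SmashProduct.single_zero _ _)
        · simpa [Ordering.coverBase, Ordering.genDeg, Ordering.coverIdx] using h
      · rw [SmashProduct.single_mul_single_of_ne _ (hg _)]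
        simpa [Ordering.coverBase, Ordering.genDeg, Ordering.coverIdx] using h
    | src_edge h i j =>
      rw [map_mul, freeLift_fgen, freeLift_fgen, SmashProduct.single_mul_single_of_eq _ (hg _)]
      · exact congrArg (SmashProduct.single _ · _) (vert_mul_edge K o h.1 i j)
      · simp only [Ordering.coverBase, Ordering.genDeg, Ordering.coverIdx, Ordering.coverS]
        -- By admissibility `w(h_ij) w(h_1j)⁻¹ = w(h_i1) w(h_11)⁻¹`, so the left index does not
        -- depend on `j`.
        rw [hw h.1 i j]
        group
    | edge_rng h i j =>
      rw [map_mul, freeLift_fgen, freeLift_fgen, SmashProduct.single_mul_single_of_eq _ (hg _)]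
      · exact congrArg (SmashProduct.single _ · _) (edge_mul_vert K o h.1 i j)
      · simp [Ordering.coverBase, Ordering.genDeg, Ordering.coverIdx, Ordering.coverR]
    | rng_ghost h i j =>
      rw [map_mul, freeLift_fgen, freeLift_fgen, SmashProduct.single_mul_single_of_eq _ (hg _)]
      · exact congrArg (SmashProduct.single _ · _) (vert_mul_ghost K o h.1 i j)
      · simp only [Ordering.coverBase, Ordering.genDeg, Ordering.coverIdx, Ordering.coverR]
        rw [hw h.1 i j]
        group
    | ghost_src h i j =>
      rw [map_mul, freeLift_fgen, freeLift_fgen, SmashProduct.single_mul_single_of_eq _ (hg _)]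
      · exact congrArg (SmashProduct.single _ · _) (ghost_mul_vert K o h.1 i j)
      · simp [Ordering.coverBase, Ordering.genDeg, Ordering.coverIdx, Ordering.coverS]
    | edge_ghost h i j =>
      -- A product keeps the index of its right factor, and that of `(h_γ)_jk^*` does not depend on
      -- `k`; the sum is thus taken inside one `p`.
      have e : ∀ k : Fin (o.n h.1),
          freeLift K (o.coveringOrdering w)
            (fun x => SmashProduct.single (grading K o hw) (gen K o (o.coverBase w x))
              (o.coverIdx w x))
            (fgen K _ (.edge h i k) * fgen K _ (.ghost h j k)) =
          SmashProduct.single (grading K o hw) (edge K o h.1 i k * ghost K o h.1 j k)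
            (w h.1 j (o.j₁ h.1) * (w h.1 (o.i₁ h.1) (o.j₁ h.1))⁻¹ * h.2) := by
        intro k
        rw [map_mul, freeLift_fgen, freeLift_fgen, SmashProduct.single_mul_single_of_eq _ (hg _)]
        · rfl
        · simp only [Ordering.coverBase, Ordering.genDeg, Ordering.coverIdx]
          rw [hw h.1 j k]
          group
      rw [map_sum, Finset.sum_congr rfl fun k _ => e k, ← SmashProduct.single_sum]
      refine (congrArg (SmashProduct.single _ · _) (sum_edge_mul_ghost K o h.1 i j)).trans ?_
      split_ifs with hij
      · subst hij
        rw [freeLift_fgen]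
        rfl
      · rw [map_zero, SmashProduct.single_zero]
    | ghost_edge h i j =>
      have e : ∀ k : Fin (o.m h.1),
          freeLift K (o.coveringOrdering w)
            (fun x => SmashProduct.single (grading K o hw) (gen K o (o.coverBase w x))
              (o.coverIdx w x))
            (fgen K _ (.ghost h k i) * fgen K _ (.edge h k j)) =
          SmashProduct.single (grading K o hw) (ghost K o h.1 k i * edge K o h.1 k j)
            ((w h.1 (o.i₁ h.1) j)⁻¹ * h.2) := by
        intro k
        rw [map_mul, freeLift_fgen, freeLift_fgen, SmashProduct.single_mul_single_of_eq _ (hg _)]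
        · rfl
        · simp only [Ordering.coverBase, Ordering.genDeg, Ordering.coverIdx]
          rw [hw h.1 k j]
          group
      rw [map_sum, Finset.sum_congr rfl fun k _ => e k, ← SmashProduct.single_sum]
      refine (congrArg (SmashProduct.single _ · _) (sum_ghost_mul_edge K o h.1 i j)).trans ?_
      split_ifs with hij
      · subst hij
        rw [freeLift_fgen]
        rfl
      · rw [map_zero, SmashProduct.single_zero])

theorem toSmash_gen (x : (o.coveringOrdering w).Gen) :
    toSmash K o hw (gen K _ x) =
      SmashProduct.single _ (gen K o (o.coverBase w x)) (o.coverIdx w x) :=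
  lift_gen _ _ x

/-- The word is lifted from its right end: each new letter on the left is lifted at the left index
of the part already lifted. -/
theorem single_word_mem_range (x : FreeSemigroup o.Gen) (γ : Γ) :
    ∃ a, toSmash K o hw a = SmashProduct.single _ (word K o x) γ := by
  have hgen : ∀ (x : o.Gen) (γ : Γ), toSmash K o hw (gen K _ (o.coverGen w x γ)) =
      SmashProduct.single _ (gen K o x) γ := by
    intro x γ
    rw [toSmash_gen, Ordering.coverBase_coverGen, Ordering.coverIdx_coverGen]
  induction x using FreeSemigroup.recOnMul with
  | ih1 x => exact ⟨_, hgen x γ⟩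
  | ih2 x y _ hy =>
    obtain ⟨b, hb⟩ := hy
    refine ⟨gen K _ (o.coverGen w x (o.wordDeg w y * γ)) * b, ?_⟩
    rw [map_mul, hgen, hb, SmashProduct.single_mul_single_of_eq _ (word_mem_part K o hw y) rfl,
      word_mul]
    rfl

theorem toSmash_surjective : Function.Surjective (toSmash K o hw) := by
  intro z
  induction z using SmashProduct.induction_on with
  | zero => exact ⟨0, map_zero _⟩
  | add x y hx hy =>
    obtain ⟨a, rfl⟩ := hx
    obtain ⟨b, rfl⟩ := hy
    exact ⟨a + b, map_add _ a b⟩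
  | single r γ =>
    have hr : r ∈ Submodule.span K (Set.range (word K o)) := by rw [span_word]; trivial
    induction hr using Submodule.span_induction with
    | mem r hr =>
      obtain ⟨x, rfl⟩ := hr
      exact single_word_mem_range K o hw x γ
    | zero => exact ⟨0, by rw [map_zero, SmashProduct.single_zero]⟩
    | add r s _ _ hr hs =>
      obtain ⟨a, ha⟩ := hr
      obtain ⟨b, hb⟩ := hs
      exact ⟨a + b, by rw [map_add, ha, hb, SmashProduct.single_add]⟩
    | smul k r _ hr =>
      obtain ⟨a, ha⟩ := hr
      exact ⟨k • a, by rw [map_smul, ha, SmashProduct.smul_single]⟩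

/-! ### Action of the base algebra by lifting to the cover -/

variable (w) in
/-- The module on which the Leavitt path algebra acts by lifting generators along the covering. -/
abbrev CoverModule : Type _ := Γ →₀ Unitization K (Leavitt K (o.coveringOrdering w))

variable (w) in
/-- The action of a generator `x`: the component at `γ` is multiplied from the left by the
generator above `x` whose right end has the index `γ`. -/
noncomputable def genAction (x : o.Gen) : Module.End K (CoverModule K o w) :=
  Finsupp.lsum K fun γ => Finsupp.lsingle (o.genDeg w x * γ) ∘ₗ
    LinearMap.mulLeft K
      (gen K _ (o.coverGen w x γ) : Unitization K (Leavitt K (o.coveringOrdering w)))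

theorem genAction_single (x : o.Gen) (γ : Γ)
    (a : Unitization K (Leavitt K (o.coveringOrdering w))) :
    genAction K o w x (Finsupp.single γ a) = Finsupp.single (o.genDeg w x * γ)
      ((gen K _ (o.coverGen w x γ) : Unitization K (Leavitt K (o.coveringOrdering w))) * a) := by
  simp [genAction]

/-- Reduces each quadratic relation of the base to the same relation between lifts in the covering
algebra. -/
theorem genAction_mul_single (x y : o.Gen) (γ : Γ)
    (a : Unitization K (Leavitt K (o.coveringOrdering w))) :
    (genAction K o w x * genAction K o w y) (Finsupp.single γ a) =
      Finsupp.single (o.genDeg w x * o.genDeg w y * γ)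
        (((gen K _ (o.coverGen w x (o.genDeg w y * γ)) * gen K _ (o.coverGen w y γ) :
          Leavitt K (o.coveringOrdering w)) :
            Unitization K (Leavitt K (o.coveringOrdering w))) * a) := by
  rw [Module.End.mul_apply, genAction_single, genAction_single, Unitization.inr_mul, mul_assoc,
    mul_assoc]

theorem inr_sum {A ι : Type*} [NonUnitalRing A] [Module K A] (s : Finset ι) (f : ι → A) :
    ((∑ i ∈ s, f i : A) : Unitization K A) = ∑ i ∈ s, (f i : Unitization K A) :=
  map_sum (Unitization.inrHom K K A) f s

/-- The representation of the Leavitt path algebra on `CoverModule`. -/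
noncomputable def coverAction : Leavitt K o →ₙₐ[K] Module.End K (CoverModule K o w) :=
  lift K o (genAction K o w) (by
    intro a b hab
    refine Finsupp.lhom_ext fun γ c => ?_
    cases hab with
    | vert_idem x =>
      rw [map_mul, freeLift_fgen, genAction_mul_single, genAction_single]
      simp only [Ordering.genDeg, Ordering.coverGen, one_mul]
      rw [show gen K (o.coveringOrdering w) (.vert (x, γ)) * gen K _ (.vert (x, γ)) = _ from
        vert_mul_self K _ _]
      rfl
    | vert_orth x y hxy =>
      have hxy' : ((x, γ) : (o.covering w).V) ≠ (y, γ) := fun e => hxy (congrArg Prod.fst e)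
      rw [map_mul, freeLift_fgen, freeLift_fgen, genAction_mul_single]
      simp only [Ordering.genDeg, Ordering.coverGen, one_mul]
      rw [show gen K (o.coveringOrdering w) (.vert (x, γ)) * gen K _ (.vert (y, γ)) = _ from
        vert_mul_of_ne K _ hxy']
      simp
    | src_edge h i j =>
      have e := vert_mul_edge K (o.coveringOrdering w) (h, w h (o.i₁ h) j * γ) i j
      rw [map_mul, freeLift_fgen, freeLift_fgen, genAction_mul_single, genAction_single]
      simp only [Ordering.genDeg, Ordering.coverGen, one_mul]
      rw [show (o.s h i, w h i j * γ) = o.coverS w (h, w h (o.i₁ h) j * γ) i by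
        simp only [Ordering.coverS]; rw [hw h i j]; simp only [mul_assoc]]
      exact congrArg (fun z : Leavitt K (o.coveringOrdering w) =>
        Finsupp.single (w h i j * γ) ((z : Unitization K _) * c)) e
    | edge_rng h i j =>
      have e := edge_mul_vert K (o.coveringOrdering w) (h, w h (o.i₁ h) j * γ) i j
      rw [map_mul, freeLift_fgen, freeLift_fgen, genAction_mul_single, genAction_single]
      simp only [Ordering.genDeg, Ordering.coverGen, mul_one]
      rw [one_mul]
      rw [show (o.r h j, γ) = o.coverR w (h, w h (o.i₁ h) j * γ) j by
        simp [Ordering.coverR]]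
      exact congrArg (fun z : Leavitt K (o.coveringOrdering w) =>
        Finsupp.single (w h i j * γ) ((z : Unitization K _) * c)) e
    | rng_ghost h i j =>
      have e := vert_mul_ghost K (o.coveringOrdering w)
        (h, w h (o.i₁ h) (o.j₁ h) * (w h i (o.j₁ h))⁻¹ * γ) i j
      rw [map_mul, freeLift_fgen, freeLift_fgen, genAction_mul_single, genAction_single]
      simp only [Ordering.genDeg, Ordering.coverGen, one_mul]
      rw [show (o.r h j, (w h i j)⁻¹ * γ) =
          o.coverR w (h, w h (o.i₁ h) (o.j₁ h) * (w h i (o.j₁ h))⁻¹ * γ) j by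
        simp only [Ordering.coverR]; rw [hw h i j]; congr 1; group]
      exact congrArg (fun z : Leavitt K (o.coveringOrdering w) =>
        Finsupp.single ((w h i j)⁻¹ * γ) ((z : Unitization K _) * c)) e
    | ghost_src h i j =>
      have e := ghost_mul_vert K (o.coveringOrdering w)
        (h, w h (o.i₁ h) (o.j₁ h) * (w h i (o.j₁ h))⁻¹ * γ) i j
      rw [map_mul, freeLift_fgen, freeLift_fgen, genAction_mul_single, genAction_single]
      simp only [Ordering.genDeg, Ordering.coverGen, mul_one]
      rw [one_mul]
      rw [show (o.s h i, γ) =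
          o.coverS w (h, w h (o.i₁ h) (o.j₁ h) * (w h i (o.j₁ h))⁻¹ * γ) i by
        simp only [Ordering.coverS]; congr 1; group]
      exact congrArg (fun z : Leavitt K (o.coveringOrdering w) =>
        Finsupp.single ((w h i j)⁻¹ * γ) ((z : Unitization K _) * c)) e
    | edge_ghost h i j =>
      -- The lift of `h_jk^*` at `γ` belongs to the hyperedge `h_δ`, whatever `k` is. By
      -- admissibility the lift of `h_ik` composed with it belongs to `h_δ` as well, so relation
      -- (iii) for `h_δ` applies.
      obtain ⟨δ, hδ⟩ : ∃ δ, δ = w h (o.i₁ h) (o.j₁ h) * (w h j (o.j₁ h))⁻¹ * γ := ⟨_, rfl⟩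
      have e := sum_edge_mul_ghost K (o.coveringOrdering w) (h, δ) i j
      have e' : ∀ k : Fin (o.n h), (genAction K o w (.edge h i k) * genAction K o w (.ghost h j k))
          (Finsupp.single γ c) = Finsupp.single (w h i (o.j₁ h) * (w h j (o.j₁ h))⁻¹ * γ)
            (((edge K (o.coveringOrdering w) (h, δ) i k * ghost K _ (h, δ) j k :
              Leavitt K (o.coveringOrdering w)) : Unitization K _) * c) := by
        intro k
        rw [genAction_mul_single]
        simp only [Ordering.genDeg, Ordering.coverGen]
        rw [show w h i k * (w h j k)⁻¹ = w h i (o.j₁ h) * (w h j (o.j₁ h))⁻¹ by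
            rw [hw h i k, hw h j k]; group,
          show w h (o.i₁ h) k * ((w h j k)⁻¹ * γ) = δ by rw [hw h j k, hδ]; group, ← hδ]
        rfl
      simp only [map_sum, map_mul, freeLift_fgen, LinearMap.sum_apply]
      rw [Finset.sum_congr rfl fun k _ => e' k, ← Finsupp.single_finsetSum, ← Finset.sum_mul,
        ← inr_sum, e]
      split_ifs with hij
      · subst hij
        rw [freeLift_fgen, genAction_single]
        simp only [Ordering.genDeg, Ordering.coverGen]
        rw [mul_inv_cancel,
          show (o.s h i, γ) = o.coverS w (h, δ) i by
            simp only [Ordering.coverS]; congr 1; rw [hδ]; group]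
        rfl
      · simp
    | ghost_edge h i j =>
      -- Here the lift of `h_kj` at `γ` fixes the hyperedge `h_δ`, and admissibility places the lift
      -- of `h_ki^*` over it too.
      obtain ⟨δ, hδ⟩ : ∃ δ, δ = w h (o.i₁ h) j * γ := ⟨_, rfl⟩
      have e := sum_ghost_mul_edge K (o.coveringOrdering w) (h, δ) i j
      have e' : ∀ k : Fin (o.m h), (genAction K o w (.ghost h k i) * genAction K o w (.edge h k j))
          (Finsupp.single γ c) = Finsupp.single ((w h (o.i₁ h) i)⁻¹ * w h (o.i₁ h) j * γ)
            (((ghost K (o.coveringOrdering w) (h, δ) k i * edge K _ (h, δ) k j :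
              Leavitt K (o.coveringOrdering w)) : Unitization K _) * c) := by
        intro k
        rw [genAction_mul_single]
        simp only [Ordering.genDeg, Ordering.coverGen]
        rw [show (w h k i)⁻¹ * w h k j = (w h (o.i₁ h) i)⁻¹ * w h (o.i₁ h) j by
            rw [hw h k i, hw h k j]; group,
          show w h (o.i₁ h) (o.j₁ h) * (w h k (o.j₁ h))⁻¹ * (w h k j * γ) = δ by
            rw [hw h k j, hδ]; group, ← hδ]
        rfl
      simp only [map_sum, map_mul, freeLift_fgen, LinearMap.sum_apply]
      rw [Finset.sum_congr rfl fun k _ => e' k, ← Finsupp.single_finsetSum, ← Finset.sum_mul,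
        ← inr_sum, e]
      split_ifs with hij
      · subst hij
        rw [freeLift_fgen, genAction_single]
        simp only [Ordering.genDeg, Ordering.coverGen]
        rw [inv_mul_cancel,
          show (o.r h i, γ) = o.coverR w (h, δ) i by simp [Ordering.coverR, hδ]]
        rfl
      · simp)

theorem coverAction_gen (x : o.Gen) : coverAction K o hw (gen K o x) = genAction K o w x :=
  lift_gen _ _ x

/-! ### The left inverse and bijectivity -/

/-- A linear left inverse of `toSmash`. -/
noncomputable def ofSmash :
    SmashProduct (grading K o hw) →ₗ[K] Leavitt K (o.coveringOrdering w) :=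
  -- The unit adjoined to the covering algebra serves as starting vector at `γ`. The components of
  -- the result are then added; for a word only one is nonzero, and it has no scalar part.
  Finsupp.lsum K fun γ =>
    Unitization.sndHom K K (Leavitt K (o.coveringOrdering w)) ∘ₗ
      (Finsupp.lsum K fun _ => LinearMap.id) ∘ₗ
        LinearMap.applyₗ (Finsupp.single γ 1) ∘ₗ
          (coverAction K o hw : Leavitt K o →ₗ[K] Module.End K (CoverModule K o w))

theorem ofSmash_single {r : Leavitt K o} {γ δ : Γ} {c : Leavitt K (o.coveringOrdering w)}
    (h : coverAction K o hw r (Finsupp.single γ 1) =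
      Finsupp.single δ (c : Unitization K (Leavitt K (o.coveringOrdering w)))) :
    ofSmash K o hw (SmashProduct.single _ r γ) = c := by
  simp only [ofSmash, SmashProduct.single]
  erw [Finsupp.lsum_single]
  simp [h]

/-- The left end of a generator of the cover has as index its degree times its right index; for
edges and ghosts this rests on admissibility. -/
theorem exists_vert_mul_gen (hw : o.IsAdmissible w) (x : (o.coveringOrdering w).Gen) :
    ∃ y, vert K (o.coveringOrdering w)
      (y, o.genDeg w (o.coverBase w x) * o.coverIdx w x) * gen K _ x = gen K _ x := by
  cases x with
  | vert x =>
    refine ⟨x.1, ?_⟩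
    simp only [Ordering.genDeg, Ordering.coverBase, Ordering.coverIdx, one_mul]
    exact vert_mul_self K (o.coveringOrdering w) x
  | edge h i j =>
    refine ⟨o.s h.1 i, ?_⟩
    have e := vert_mul_edge K (o.coveringOrdering w) h i j
    rw [show (o.s h.1 i, _) = o.coverS w h i from ?_]
    · exact e
    · simp only [Ordering.coverS, Ordering.genDeg, Ordering.coverBase, Ordering.coverIdx]
      rw [hw h.1 i j]; congr 1; group
  | ghost h i j =>
    refine ⟨o.r h.1 j, ?_⟩
    have e := vert_mul_ghost K (o.coveringOrdering w) h i j
    rw [show (o.r h.1 j, _) = o.coverR w h j from ?_]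
    · exact e
    · simp only [Ordering.coverR, Ordering.genDeg, Ordering.coverBase, Ordering.coverIdx]
      rw [hw h.1 i j]; congr 1; group

theorem exists_gen_mul_vert (x : (o.coveringOrdering w).Gen) :
    ∃ y, gen K _ x * vert K (o.coveringOrdering w) (y, o.coverIdx w x) = gen K _ x := by
  cases x with
  | vert x => exact ⟨x.1, vert_mul_self K (o.coveringOrdering w) x⟩
  | edge h i j => exact ⟨o.r h.1 j, edge_mul_vert K (o.coveringOrdering w) h i j⟩
  | ghost h i j => exact ⟨o.s h.1 i, ghost_mul_vert K (o.coveringOrdering w) h i j⟩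

/-- Here `c` is the lift of the word ending at `γ`. Its left vertex is recorded because
`ofSmash_mul` needs `c` to be annihilated by generators whose right index does not match. -/
theorem exists_coverAction_word (x : FreeSemigroup o.Gen) (γ : Γ) :
    ∃ (c : Leavitt K (o.coveringOrdering w)) (y : H.V),
      coverAction K o hw (word K o x) (Finsupp.single γ 1) =
        Finsupp.single (o.wordDeg w x * γ)
          (c : Unitization K (Leavitt K (o.coveringOrdering w))) ∧
      vert K (o.coveringOrdering w) (y, o.wordDeg w x * γ) * c = c := by
  have hgen : ∀ (x : o.Gen) (γ : Γ), ∃ y, vert K (o.coveringOrdering w)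
      (y, o.genDeg w x * γ) * gen K _ (o.coverGen w x γ) = gen K _ (o.coverGen w x γ) := by
    intro x γ
    have h := exists_vert_mul_gen K o hw (o.coverGen w x γ)
    rwa [Ordering.coverBase_coverGen, Ordering.coverIdx_coverGen] at h
  induction x using FreeSemigroup.recOnMul with
  | ih1 x =>
    obtain ⟨y, hy⟩ := hgen x γ
    refine ⟨gen K _ (o.coverGen w x γ), y, ?_, hy⟩
    have h := genAction_single K o (w := w) x γ 1
    rw [mul_one, ← coverAction_gen K o hw] at h
    exact h
  | ih2 x z _ hz =>
    -- The left vertex of the shorter word is not needed: that of the product comes from its first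
    -- letter.
    obtain ⟨c, -, hc, -⟩ := hz
    obtain ⟨y, hy⟩ := hgen x (o.wordDeg w z * γ)
    have hd : o.wordDeg w (FreeSemigroup.of x * z) * γ =
        o.genDeg w x * (o.wordDeg w z * γ) := by
      rw [map_mul, mul_assoc]
      rfl
    refine ⟨gen K _ (o.coverGen w x (o.wordDeg w z * γ)) * c, y, ?_, ?_⟩
    · rw [word_mul, map_mul, Module.End.mul_apply, hc, word_of, coverAction_gen,
        genAction_single, Unitization.inr_mul, hd]
    · rw [hd, ← mul_assoc, hy]

/-- It suffices to take `z = r p_γ` with `r` a word. If the indices match, both sides are the lift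
of the longer word; if not, both vanish. -/
theorem ofSmash_mul (x : (o.coveringOrdering w).Gen) (z : SmashProduct (grading K o hw)) :
    ofSmash K o hw (toSmash K o hw (gen K _ x) * z) = gen K _ x * ofSmash K o hw z := by
  induction z using SmashProduct.induction_on with
  | zero => simp
  | add y z hy hz => rw [mul_add, map_add, map_add, hy, hz, mul_add]
  | single r γ =>
    have hr : r ∈ Submodule.span K (Set.range (word K o)) := by rw [span_word]; trivial
    induction hr using Submodule.span_induction with
    | zero => simp [SmashProduct.single_zero]
    | add r s _ _ hr hs =>
      rw [SmashProduct.single_add, mul_add, map_add, map_add, hr, hs, mul_add]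
    | smul k r _ hr =>
      rw [← SmashProduct.smul_single, mul_smul_comm, map_smul, map_smul, hr, mul_smul_comm]
    | mem r hr =>
      obtain ⟨y, rfl⟩ := hr
      obtain ⟨c, v, hc, hv⟩ := exists_coverAction_word K o hw y γ
      rw [toSmash_gen, ofSmash_single K o hw hc]
      by_cases h : o.coverIdx w x = o.wordDeg w y * γ
      · rw [SmashProduct.single_mul_single_of_eq _ (word_mem_part K o hw y) h]
        refine ofSmash_single K o hw (δ := o.genDeg w (o.coverBase w x) * o.coverIdx w x) ?_
        rw [map_mul, Module.End.mul_apply, hc, ← h, coverAction_gen, genAction_single,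
          Ordering.coverGen_coverBase, Unitization.inr_mul]
      -- The left side is zero in the smash product. On the right, vertices of different index are
      -- inserted between the two factors, and they are orthogonal.
      · obtain ⟨u, hu⟩ := exists_gen_mul_vert K o x
        rw [SmashProduct.single_mul_single_of_ne _ (word_mem_part K o hw y) h, map_zero, ← hu,
          ← hv, mul_assoc, ← mul_assoc (vert K _ _) (vert K _ _) c, vert_mul_of_ne, zero_mul,
          mul_zero]
        exact fun e => h (congrArg Prod.snd e)

theorem ofSmash_toSmash (a : Leavitt K (o.coveringOrdering w)) :
    ofSmash K o hw (toSmash K o hw a) = a := by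
  have ha : a ∈ Submodule.span K (Set.range (word K (o.coveringOrdering w))) := by
    rw [span_word]; trivial
  induction ha using Submodule.span_induction with
  | zero => rw [map_zero, map_zero]
  | add a b _ _ ha hb => rw [map_add, map_add, ha, hb]
  | smul k a _ ha => rw [map_smul, map_smul, ha]
  | mem a ha =>
    obtain ⟨x, rfl⟩ := ha
    induction x using FreeSemigroup.recOnMul with
    | ih1 x =>
      change ofSmash K o hw (toSmash K o hw (gen K _ x)) = gen K _ x
      rw [toSmash_gen]
      refine ofSmash_single K o hw (δ := o.genDeg w (o.coverBase w x) * o.coverIdx w x) ?_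
      rw [coverAction_gen, genAction_single, Ordering.coverGen_coverBase, mul_one]
    | ih2 x y _ hy => rw [word_mul, map_mul, word_of, ofSmash_mul, hy]

theorem toSmash_bijective : Function.Bijective (toSmash K o hw) :=
  ⟨Function.LeftInverse.injective (ofSmash_toSmash K o hw), toSmash_surjective K o hw⟩

end Cover

end Leavitt

theorem mainTheorem11 {K : Type*} [Field K] {Γ : Type*} [Group Γ] (H : DirHypergraph.{u, v})
    (o : H.Ordering) (w : ∀ h : H.E, Fin (o.m h) → Fin (o.n h) → Γ) (hw : o.IsAdmissible w) :
    ∃ φ : Leavitt K (o.coveringOrdering w) →ₙₐ[K] SmashProduct (Leavitt.grading K o hw),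
      Function.Bijective φ ∧
      (∀ (x : H.V) (γ : Γ),
        φ (Leavitt.vert K (o.coveringOrdering w) (x, γ)) =
          SmashProduct.single _ (Leavitt.vert K o x) γ) ∧
      (∀ (h : H.E) (γ : Γ) (i : Fin (o.m h)) (j : Fin (o.n h)),
        φ (Leavitt.edge K (o.coveringOrdering w) (h, γ) i j) =
          SmashProduct.single _ (Leavitt.edge K o h i j) ((w h (o.i₁ h) j)⁻¹ * γ)) ∧
      (∀ (h : H.E) (γ : Γ) (i : Fin (o.m h)) (j : Fin (o.n h)),
        φ (Leavitt.ghost K (o.coveringOrdering w) (h, γ) i j) =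
          SmashProduct.single _ (Leavitt.ghost K o h i j)
            (w h i (o.j₁ h) * (w h (o.i₁ h) (o.j₁ h))⁻¹ * γ)) := by
  exact ⟨Leavitt.toSmash K o hw, Leavitt.toSmash_bijective K o hw,
    fun _ _ => Leavitt.toSmash_gen K o hw _, fun _ _ _ _ => Leavitt.toSmash_gen K o hw _,
    fun _ _ _ _ => Leavitt.toSmash_gen K o hw _⟩
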